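/- Let $X$ be an infinite-dimensional real or complex Banach space and let $T$ be a bounded linear operator on $X$. Suppose there is an infinite, strictly decreasing chain $V_1\supsetneq V_2\supsetneq V_3\supsetneq\cdots$ of closed linear subspaces of $X$ such that $TV_n\subseteq V_{n+1}$ for every $n\ge 1$. Then $T$ admits an almost-invariant halfspace of defect at most $1$. That is, there is a closed linear subspace $Y$ of $X$ with $\dim Y=\dim(X/Y)=\infty$ such that $TY\subseteq Y+E$ for some finite-dimensional linear subspace $E$ of $X$, and the minimum possible dimension of such a subspace $E$ (the defect of $Y$ under $T$) is at most $1$. -/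

import Mathlib

/-- A halfspace of a normed space: a norm-closed subspace whose dimension and codimension are both
infinite. -/
def IsHalfspace {𝕜 : Type*} {X : Type*} [RCLike 𝕜] [NormedAddCommGroup X] [NormedSpace 𝕜 X]
    (Y : Submodule 𝕜 X) : Prop :=
  IsClosed (Y : Set X) ∧ ¬ FiniteDimensional 𝕜 Y ∧ ¬ FiniteDimensional 𝕜 (X ⧸ Y)

/-- `E` is an error subspace for `Y` under `T`: `E` is finite-dimensional and `T Y ⊆ Y + E`. -/
def IsErrorSubspace {𝕜 : Type*} {X : Type*} [RCLike 𝕜] [NormedAddCommGroup X] [NormedSpace 𝕜 X]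
    (T : X →L[𝕜] X) (Y E : Submodule 𝕜 X) : Prop :=
  FiniteDimensional 𝕜 E ∧ ∀ y ∈ Y, T y ∈ Y ⊔ E

/-- `Y` is almost-invariant under `T`: it has some (finite-dimensional) error subspace. -/
def IsAlmostInvariant {𝕜 : Type*} {X : Type*} [RCLike 𝕜] [NormedAddCommGroup X]
    [NormedSpace 𝕜 X] (T : X →L[𝕜] X) (Y : Submodule 𝕜 X) : Prop :=
  ∃ E : Submodule 𝕜 X, IsErrorSubspace T Y E

/-- The defect of `Y` under `T`: the least dimension of an error subspace. It is `⊤` when `Y` is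
not almost-invariant. -/
noncomputable def defect {𝕜 : Type*} {X : Type*} [RCLike 𝕜] [NormedAddCommGroup X]
    [NormedSpace 𝕜 X] (T : X →L[𝕜] X) (Y : Submodule 𝕜 X) : ℕ∞ :=
  ⨅ (E : Submodule 𝕜 X) (_ : IsErrorSubspace T Y E), (Module.finrank 𝕜 E : ℕ∞)

/-- An almost-invariant halfspace (AIHS) under `T`. -/
def IsAIHS {𝕜 : Type*} {X : Type*} [RCLike 𝕜] [NormedAddCommGroup X] [NormedSpace 𝕜 X]
    (T : X →L[𝕜] X) (Y : Submodule 𝕜 X) : Prop :=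
  IsHalfspace Y ∧ IsAlmostInvariant T Y

/-! A biorthogonal sequence of eigenvectors modulo one fixed vector `e` suffices: the closed span of
its even members is a halfspace that `T` maps into itself plus the line of `e`. Dividing by the
intersection of the chain makes that intersection zero. If the kernel is then infinite-dimensional,
it contains such a sequence. Otherwise `T` is injective on some `V N`, is not onto there, and has no
nonzero eigenvalue, since an eigenvector would lie in every `V n`. So 0 is spectral, and resolvents
at real points decreasing to the largest real spectral value `t` blow up at some vector `x`. The
normalised orbits `h k` satisfy `T (h k) = s (ψ k) • h k - ε • x` with `ε → 0`; a limit would be a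
unit eigenvector for `t`, so there is none. A bounded family with no limit along an ultrafilter has
a biorthogonal subfamily: Mazur's selection is applied in the bidual to `h - ξ`, with `ξ` the
weak-star limit (`exists_biorthogonal_of_not_tendsto`). -/

open Filter Topology Module

/-! ### Biorthogonal systems and halfspaces -/

/-- A continuous functional vanishing on a closed subspace and equal to one at a given point
outside of it. -/
theorem exists_dual_eq_one_of_notMem {𝕜 X : Type*} [RCLike 𝕜] [NormedAddCommGroup X]
    [NormedSpace 𝕜 X] {M : Submodule 𝕜 X} (hM : IsClosed (M : Set X)) {x : X} (hx : x ∉ M) :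
    ∃ f : StrongDual 𝕜 X, (∀ y ∈ M, f y = 0) ∧ f x = 1 := by
  have := hM
  have hx' : M.mkQL x ≠ 0 := by simpa using hx
  obtain ⟨g, hg⟩ := SeparatingDual.exists_eq_one (R := 𝕜) hx'
  refine ⟨g.comp M.mkQL, fun y hy => ?_, hg⟩
  have : M.mkQL y = 0 := by simpa using hy
  rw [ContinuousLinearMap.comp_apply, this, map_zero]

/-- The closed span of every second member of a biorthogonal system is a halfspace. -/
theorem isHalfspace_closure_span_even {𝕜 X : Type*} [RCLike 𝕜] [NormedAddCommGroup X]
    [NormedSpace 𝕜 X] (x : ℕ → X) (f : ℕ → StrongDual 𝕜 X) (h1 : ∀ i, f i (x i) = 1)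
    (h0 : ∀ i j, i ≠ j → f i (x j) = 0) :
    IsHalfspace (Submodule.span 𝕜 (Set.range fun k => x (2 * k))).topologicalClosure := by
  set Y := (Submodule.span 𝕜 (Set.range fun k => x (2 * k))).topologicalClosure with hY
  have hmem : ∀ k, x (2 * k) ∈ Y := fun k =>
    Submodule.le_topologicalClosure _ (Submodule.subset_span ⟨k, rfl⟩)
  refine ⟨Submodule.isClosed_topologicalClosure _, fun hfd => ?_, fun hfd => ?_⟩
  · have hli : LinearIndependent 𝕜 fun k : ℕ => (⟨x (2 * k), hmem k⟩ : Y) := by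
      refine LinearIndependent.of_pairwise_dual_eq_zero_one _
        (fun i => (f (2 * i)).toLinearMap ∘ₗ Y.subtype) ?_ ?_
      · intro i j hij
        exact h0 _ _ (by omega)
      · intro i
        exact h1 _
    exact not_finite_iff_infinite.2 (inferInstanceAs (Infinite ℕ)) hli.finite
  -- The odd functionals annihilate `Y`, so they descend to the quotient and separate the odd
  -- vectors there.
  · have hker : ∀ i, Y ≤ LinearMap.ker (f (2 * i + 1)).toLinearMap := by
      intro i
      refine Submodule.topologicalClosure_minimal _ ?_ (f (2 * i + 1)).isClosed_ker
      rw [Submodule.span_le]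
      rintro _ ⟨k, rfl⟩
      exact h0 _ _ (by omega)
    have hli : LinearIndependent 𝕜 fun k : ℕ => Y.mkQ (x (2 * k + 1)) := by
      refine LinearIndependent.of_pairwise_dual_eq_zero_one _
        (fun i => Y.liftQ (f (2 * i + 1)).toLinearMap (hker i)) ?_ ?_
      · intro i j hij
        exact h0 _ _ (by omega)
      · intro i
        exact h1 _
    exact not_finite_iff_infinite.2 (inferInstanceAs (Infinite ℕ)) hli.finite

/-! ### Mazur selection of biorthogonal subfamilies -/

/-- If each `F (k + 1)` is spanned by `F k` and `w k`, and the norm on `F k` is controlled by the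
norm on `F k + ⟨w k⟩` with constants telescoping to a bounded product, then `w` has a biorthogonal
system of functionals vanishing on `F 0`. -/
theorem exists_biorthogonal_of_telescoping {𝕜 Z : Type*} [RCLike 𝕜] [NormedAddCommGroup Z]
    [NormedSpace 𝕜 Z] (F : ℕ → Submodule 𝕜 Z) (w : ℕ → Z) (c : ℕ → ℝ) (C : ℝ)
    (hF : ∀ k, F (k + 1) = F k ⊔ Submodule.span 𝕜 {w k}) (hw : ∀ k, w k ≠ 0)
    (hc1 : ∀ k, 1 ≤ c k) (hc2 : ∀ k, c k ≤ C)
    (hFw : ∀ k, ∀ f ∈ F k, ∀ a : 𝕜, c k * ‖f‖ ≤ c (k + 1) * ‖f + a • w k‖) :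
    ∃ g : ℕ → StrongDual 𝕜 Z, (∀ i, ∀ f ∈ F 0, g i f = 0) ∧ (∀ i, g i (w i) = 1) ∧
      ∀ i j, i ≠ j → g i (w j) = 0 := by
  have hC : 1 ≤ C := (hc1 0).trans (hc2 0)
  have hmono : Monotone F := monotone_nat_of_le_succ fun k => by rw [hF]; exact le_sup_left
  have hwF : ∀ k, w k ∈ F (k + 1) := fun k => by
    rw [hF]; exact Submodule.mem_sup_right (Submodule.mem_span_singleton_self _)
  have key : ∀ j m, ∀ f ∈ F j, ∀ v ∈ Submodule.span 𝕜 (w '' Set.Ico j (j + m)),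
      c j * ‖f‖ ≤ c (j + m) * ‖f + v‖ := by
    intro j m
    induction m with
    | zero =>
      intro f hf v hv
      simp only [add_zero, Set.Ico_self, Set.image_empty, Submodule.span_empty,
        Submodule.mem_bot] at hv
      simp [hv]
    | succ m ih =>
      intro f hf v hv
      have hIco : Set.Ico j (j + (m + 1)) = insert (j + m) (Set.Ico j (j + m)) := by
        ext i; simp only [Set.mem_Ico, Set.mem_insert_iff]; omega
      rw [hIco, Set.image_insert_eq, Submodule.mem_span_insert] at hv
      obtain ⟨a, v', hv', rfl⟩ := hv
      have hvF : v' ∈ F (j + m) := by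
        refine (Submodule.span_le.2 ?_) hv'
        rintro _ ⟨i, hi, rfl⟩
        exact hmono (by have := hi.2; omega) (hwF i)
      refine (ih f hf v' hv').trans ?_
      have := hFw (j + m) (f + v') (add_mem (hmono (by omega) hf) hvF) a
      rw [add_comm (a • _) v', ← add_assoc f]
      exact this
  have key' : ∀ j, ∀ f ∈ F j, ∀ v ∈ Submodule.span 𝕜 (w '' Set.Ici j), ‖f‖ ≤ C * ‖f + v‖ := by
    intro j f hf v hv
    have : ∃ m, v ∈ Submodule.span 𝕜 (w '' Set.Ico j (j + m)) := by
      induction hv using Submodule.span_induction with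
      | mem x hx =>
        obtain ⟨i, hi, rfl⟩ := hx
        have hi' : j ≤ i := hi
        exact ⟨i - j + 1, Submodule.subset_span ⟨i, ⟨hi', by omega⟩, rfl⟩⟩
      | zero => exact ⟨0, zero_mem _⟩
      | add x y _ _ hx hy =>
        obtain ⟨m, hm⟩ := hx
        obtain ⟨n, hn⟩ := hy
        have hle : ∀ {p q : ℕ}, p ≤ q → Submodule.span 𝕜 (w '' Set.Ico j (j + p)) ≤
            Submodule.span 𝕜 (w '' Set.Ico j (j + q)) := fun hpq =>
          Submodule.span_mono (Set.image_mono (Set.Ico_subset_Ico_right (by omega)))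
        exact ⟨max m n, add_mem (hle (le_max_left _ _) hm) (hle (le_max_right _ _) hn)⟩
      | smul a x _ hx =>
        obtain ⟨m, hm⟩ := hx
        exact ⟨m, Submodule.smul_mem _ a hm⟩
    obtain ⟨m, hm⟩ := this
    have h := key j m f hf v hm
    calc ‖f‖ ≤ c j * ‖f‖ := le_mul_of_one_le_left (norm_nonneg _) (hc1 j)
      _ ≤ c (j + m) * ‖f + v‖ := h
      _ ≤ C * ‖f + v‖ := by gcongr; exact hc2 _
  have main : ∀ k, ∃ g : StrongDual 𝕜 Z, (∀ f ∈ F k, g f = 0) ∧ g (w k) = 1 ∧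
      ∀ j, k < j → g (w j) = 0 := by
    intro k
    set N := F k ⊔ Submodule.span 𝕜 (w '' Set.Ici (k + 1)) with hN
    -- For `y = f + v`, both `w k - f` and `f` have norm at most `C * ‖w k - y‖`, by splitting off
    -- the tail after, respectively before, `w k`; hence the factor 2.
    have hdist : ∀ y ∈ N, ‖w k‖ ≤ 2 * C * ‖w k - y‖ := by
      intro y hy
      obtain ⟨f, hf, v, hv, rfl⟩ := Submodule.mem_sup.1 hy
      have e1 := key' (k + 1) (w k - f) (sub_mem (hwF k) (hmono (Nat.le_succ k) hf)) (-v)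
        (neg_mem hv)
      have e2 := key' k (-f) (neg_mem hf) (w k - v) (by
        refine sub_mem (Submodule.subset_span ⟨k, Set.mem_Ici.2 le_rfl, rfl⟩)
          (Submodule.span_mono (Set.image_mono ?_) hv)
        exact Set.Ici_subset_Ici.2 (Nat.le_succ k))
      have e3 : ‖w k‖ ≤ ‖w k - f‖ + ‖-f‖ := by
        rw [norm_neg]
        simpa using norm_add_le (w k - f) f
      rw [show w k - f + -v = w k - (f + v) by abel] at e1
      rw [show -f + (w k - v) = w k - (f + v) by abel] at e2
      linarith
    have hnot : w k ∉ N.topologicalClosure := by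
      intro hmem
      rw [← SetLike.mem_coe, Submodule.topologicalClosure_coe, Metric.mem_closure_iff] at hmem
      have hpos : 0 < ‖w k‖ := norm_pos_iff.2 (hw k)
      obtain ⟨y, hy, hlt⟩ := hmem (‖w k‖ / (2 * C)) (by positivity)
      rw [dist_eq_norm, lt_div_iff₀ (by positivity)] at hlt
      have := hdist y hy
      linarith
    obtain ⟨g, hg0, hg1⟩ := exists_dual_eq_one_of_notMem
      (Submodule.isClosed_topologicalClosure N) hnot
    refine ⟨g, fun f hf => hg0 _ (Submodule.le_topologicalClosure _ (Submodule.mem_sup_left hf)),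
      hg1, fun j hj => hg0 _ (Submodule.le_topologicalClosure _ (Submodule.mem_sup_right
        (Submodule.subset_span ⟨j, hj, rfl⟩)))⟩
  choose g hg0 hg1 hg2 using main
  refine ⟨g, fun i f hf => hg0 i f (hmono (Nat.zero_le i) hf), hg1, fun i j hij => ?_⟩
  rcases lt_or_gt_of_ne hij with h | h
  · exact hg2 i j h
  · exact hg0 i _ (hmono h (hwF j))

/-- If every finite-dimensional subspace admits arbitrarily good almost orthogonal members of the
family `u`, then `u` has a subfamily with a biorthogonal system vanishing at a given point. -/
theorem exists_biorthogonal_of_forall_finiteDimensional {𝕜 Z ι : Type*} [RCLike 𝕜]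
    [NormedAddCommGroup Z] [NormedSpace 𝕜 Z] (u : ι → Z) (ξ : Z)
    (step : ∀ (F : Submodule 𝕜 Z), FiniteDimensional 𝕜 F → ∀ η : ℝ, 1 < η →
      ∃ n, u n ≠ 0 ∧ ∀ f ∈ F, ∀ a : 𝕜, ‖f‖ ≤ η * ‖f + a • u n‖) :
    ∃ (φ : ℕ → ι) (g : ℕ → StrongDual 𝕜 Z), (∀ i, g i ξ = 0) ∧ (∀ i, g i (u (φ i)) = 1) ∧
      ∀ i j, i ≠ j → g i (u (φ j)) = 0 := by
  -- Strictly increasing from 1 and below 2: each ratio `c (k + 1) / c k` exceeds 1, as `step`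
  -- needs, while the products telescope.
  let c : ℕ → ℝ := fun k => 2 - 1 / (k + 1)
  have hc1 : ∀ k, 1 ≤ c k := fun k => by
    have : (1 : ℝ) / (k + 1) ≤ 1 := by
      rw [div_le_one (by positivity)]; linarith [(Nat.cast_nonneg k : (0 : ℝ) ≤ k)]
    simp only [c]; linarith
  have hc2 : ∀ k, c k ≤ 2 := fun k => by
    have : (0 : ℝ) ≤ 1 / (k + 1) := by positivity
    simp only [c]; linarith
  have hc3 : ∀ k, c k < c (k + 1) := fun k => by
    have : (1 : ℝ) / ((k + 1 : ℕ) + 1) < 1 / (k + 1) := by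
      push_cast
      gcongr
      linarith
    simp only [c]; linarith
  have step' : ∀ (k : ℕ) (F : {F : Submodule 𝕜 Z // FiniteDimensional 𝕜 F}),
      ∃ n, u n ≠ 0 ∧ ∀ f ∈ F.1, ∀ a : 𝕜, c k * ‖f‖ ≤ c (k + 1) * ‖f + a • u n‖ := by
    rintro k ⟨F, hF⟩
    have hck : 0 < c k := by linarith [hc1 k]
    have hη : 1 < c (k + 1) / c k := by rw [one_lt_div hck]; exact hc3 k
    obtain ⟨n, hn0, hn⟩ := step F hF _ hη
    refine ⟨n, hn0, fun f hf a => ?_⟩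
    have := mul_le_mul_of_nonneg_left (hn f hf a) hck.le
    rwa [← mul_assoc, mul_div_cancel₀ _ hck.ne'] at this
  choose N hN0 hN using step'
  -- Starting from the line of `ξ` forces every functional to vanish at `ξ`.
  let F : ℕ → {F : Submodule 𝕜 Z // FiniteDimensional 𝕜 F} :=
    fun k => Nat.rec ⟨Submodule.span 𝕜 {ξ}, inferInstance⟩
      (fun k F => ⟨F.1 ⊔ Submodule.span 𝕜 {u (N k F)}, by have := F.2; infer_instance⟩) k
  obtain ⟨g, hg0, hg1, hg2⟩ := exists_biorthogonal_of_telescoping (fun k => (F k).1)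
    (fun k => u (N k (F k))) c 2 (fun k => rfl) (fun k => hN0 _ _) hc1 hc2
    (fun k => hN k (F k))
  exact ⟨fun k => N k (F k), g, fun i => hg0 i ξ (Submodule.mem_span_singleton_self ξ), hg1, hg2⟩

theorem exists_tendsto_ultrafilter_of_norm_le {ι E : Type*} [NormedAddCommGroup E] [ProperSpace E]
    (U : Ultrafilter ι) (y : ι → E) {R : ℝ} (hy : ∀ᶠ n in U, ‖y n‖ ≤ R) :
    ∃ z, Tendsto y U (𝓝 z) := by
  obtain ⟨z, -, hz⟩ := (isCompact_closedBall (0 : E) R).ultrafilter_le_nhds' (U.map y) (by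
    rw [Ultrafilter.mem_map]
    filter_upwards [hy] with n hn
    simpa using hn)
  exact ⟨z, hz⟩

/-- Mazur's selection step: with respect to a norming set of functionals, a weakly null family
which is bounded below is eventually almost orthogonal to a given finite-dimensional subspace. -/
theorem eventually_norm_le_mul_norm_add_smul {𝕜 Z D ι : Type*} [RCLike 𝕜] [NormedAddCommGroup Z]
    [NormedSpace 𝕜 Z] (ev : D → StrongDual 𝕜 Z)
    (hev : ∀ (z : Z) (R : ℝ), 0 ≤ R → (∀ d, ‖ev d z‖ ≤ ‖ev d‖ * R) → ‖z‖ ≤ R)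
    (U : Ultrafilter ι) (u : ι → Z) (hu : ∀ d, Tendsto (fun n => ev d (u n)) U (𝓝 0))
    {δ : ℝ} (hδ : 0 < δ) (huδ : ∀ᶠ n in U, δ ≤ ‖u n‖) (F : Submodule 𝕜 Z)
    [FiniteDimensional 𝕜 F] {η : ℝ} (hη : 1 < η) :
    ∀ᶠ n in U, ∀ f ∈ F, ∀ a : 𝕜, ‖f‖ ≤ η * ‖f + a • u n‖ := by
  have hη0 : 0 < η := by linarith
  by_contra hcon
  rw [← Ultrafilter.eventually_not] at hcon
  have hex : ∀ n, ∃ f : F, ∃ a : 𝕜, (¬ ∀ f ∈ F, ∀ a : 𝕜, ‖f‖ ≤ η * ‖f + a • u n‖) →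
      ‖f‖ = 1 ∧ ‖(f : Z) + a • u n‖ ≤ η⁻¹ := by
    intro n
    by_cases hn : ∀ f ∈ F, ∀ a : 𝕜, ‖f‖ ≤ η * ‖f + a • u n‖
    · exact ⟨0, 0, fun h => absurd hn h⟩
    · push Not at hn
      obtain ⟨f, hf, a, hlt⟩ := hn
      have hf0 : 0 < ‖f‖ := lt_of_le_of_lt (by positivity) hlt
      refine ⟨((‖f‖⁻¹ : ℝ) : 𝕜) • ⟨f, hf⟩, ((‖f‖⁻¹ : ℝ) : 𝕜) * a, fun _ => ⟨?_, ?_⟩⟩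
      · rw [norm_smul, RCLike.norm_ofReal, abs_of_pos (inv_pos.2 hf0)]
        exact inv_mul_cancel₀ hf0.ne'
      · have : ((((‖f‖⁻¹ : ℝ) : 𝕜) • (⟨f, hf⟩ : F) : F) : Z)
            + (((‖f‖⁻¹ : ℝ) : 𝕜) * a) • u n = ((‖f‖⁻¹ : ℝ) : 𝕜) • (f + a • u n) := by
          rw [smul_add, smul_smul]; rfl
        rw [this, norm_smul, RCLike.norm_ofReal, abs_of_pos (inv_pos.2 hf0),
          inv_mul_le_iff₀ hf0, ← div_eq_mul_inv, le_div_iff₀ hη0, mul_comm]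
        exact hlt.le
  choose f a hfa using hex
  have hfa' := hcon.mono fun n hn => hfa n hn
  have : ProperSpace F := FiniteDimensional.proper_rclike 𝕜 F
  obtain ⟨f₀, hf₀⟩ := exists_tendsto_ultrafilter_of_norm_le U f (hfa'.mono fun n hn => hn.1.le)
  obtain ⟨a₀, ha₀⟩ := exists_tendsto_ultrafilter_of_norm_le U a (R := 2 / δ) (by
    filter_upwards [hfa', huδ] with n hn hδn
    have h1 : ‖a n • u n‖ ≤ 2 := by
      have h2 : ‖a n • u n‖ ≤ ‖(f n : Z) + a n • u n‖ + ‖(f n : Z)‖ := by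
        simpa using norm_sub_le ((f n : Z) + a n • u n) (f n)
      have h3 : ‖(f n : Z)‖ = 1 := hn.1
      have h4 : η⁻¹ ≤ 1 := inv_le_one_of_one_le₀ hη.le
      linarith [hn.2]
    rw [norm_smul] at h1
    rw [le_div_iff₀ hδ]
    exact (mul_le_mul_of_nonneg_left hδn (norm_nonneg _)).trans h1)
  have hnorm : ‖f₀‖ = 1 := tendsto_nhds_unique hf₀.norm
    (tendsto_const_nhds.congr' (hfa'.mono fun n hn => hn.1.symm))
  -- The scalars `a n` converge, so `a n • u n` is still weakly null and `f₀` is the weak limit of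
  -- vectors of norm at most `η⁻¹ < 1`.
  have hle : ‖(f₀ : Z)‖ ≤ η⁻¹ := by
    refine hev _ _ (inv_nonneg.2 hη0.le) fun d => ?_
    have h1 : Tendsto (fun n => ev d (f n)) U (𝓝 (ev d f₀)) :=
      (((ev d).continuous.comp continuous_subtype_val).tendsto f₀).comp hf₀
    have h2 : Tendsto (fun n => ev d (f n + a n • u n)) U (𝓝 (ev d f₀)) := by
      simpa using h1.add (ha₀.mul (hu d))
    refine le_of_tendsto h2.norm ?_
    filter_upwards [hfa'] with n hn
    exact ((ev d).le_opNorm _).trans (by gcongr; exact hn.2)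
  have : η⁻¹ < 1 := inv_lt_one_of_one_lt₀ hη
  have h1 : ‖(f₀ : Z)‖ = 1 := hnorm
  linarith

/-- A sequence in a Banach space which does not converge along an ultrafilter, but does converge
weakly to a point of a larger space, has a subfamily admitting a biorthogonal system. -/
theorem exists_biorthogonal_of_tendsto_weakly {𝕜 X Z D ι : Type*} [RCLike 𝕜]
    [NormedAddCommGroup X] [NormedSpace 𝕜 X] [CompleteSpace X] [NormedAddCommGroup Z]
    [NormedSpace 𝕜 Z] (J : X →ₗᵢ[𝕜] Z) (ev : D → StrongDual 𝕜 Z)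
    (hev : ∀ (z : Z) (R : ℝ), 0 ≤ R → (∀ d, ‖ev d z‖ ≤ ‖ev d‖ * R) → ‖z‖ ≤ R)
    (U : Ultrafilter ι) (h : ι → X) (hU : ∀ x, ¬ Tendsto h U (𝓝 x)) (ξ : Z)
    (hξ : ∀ d, Tendsto (fun n => ev d (J (h n))) U (𝓝 (ev d ξ))) :
    ∃ (φ : ℕ → ι) (f : ℕ → StrongDual 𝕜 X), (∀ i, f i (h (φ i)) = 1) ∧
      ∀ i j, i ≠ j → f i (h (φ j)) = 0 := by
  set u : ι → Z := fun n => J (h n) - ξ with hu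
  have hu0 : ∀ d, Tendsto (fun n => ev d (u n)) U (𝓝 0) := fun d => by
    simpa [hu] using (hξ d).sub_const (ev d ξ)
  -- Otherwise `J (h n)` tends to `ξ` in norm; the range of `J` is closed by completeness, so `h`
  -- would converge in `X`.
  obtain ⟨δ, hδ, huδ⟩ : ∃ δ > 0, ∀ᶠ n in U, δ ≤ ‖u n‖ := by
    by_contra! hcon
    have hlim : Tendsto (fun n => J (h n)) U (𝓝 ξ) := by
      rw [tendsto_iff_norm_sub_tendsto_zero, Metric.tendsto_nhds]
      intro ε hε
      have := hcon ε hε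
      filter_upwards [this] with n hn
      simpa using hn
    obtain ⟨x, rfl⟩ : ξ ∈ Set.range J :=
      J.isometry.isClosedEmbedding.isClosed_range.mem_of_tendsto hlim
        (Eventually.of_forall fun n => ⟨_, rfl⟩)
    exact hU x (J.isometry.isEmbedding.tendsto_nhds_iff.2 hlim)
  obtain ⟨φ, g, hgξ, hg1, hg2⟩ := exists_biorthogonal_of_forall_finiteDimensional (𝕜 := 𝕜) u ξ
    (fun F hF η hη => by
      obtain ⟨n, hn, hδn⟩ :=
        ((eventually_norm_le_mul_norm_add_smul ev hev U u hu0 hδ huδ F hη).and huδ).exists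
      exact ⟨n, norm_pos_iff.1 (hδ.trans_le hδn), hn⟩)
  have hgJ : ∀ i n, g i (J (h n)) = g i (u n) := fun i n => by simp [hu, hgξ]
  exact ⟨φ, fun i => (g i).comp J.toContinuousLinearMap, fun i => (hgJ _ _).trans (hg1 i),
    fun i j hij => (hgJ _ _).trans (hg2 i j hij)⟩

/-- A bounded family in a Banach space which does not converge along some ultrafilter has a
subfamily admitting a biorthogonal system of functionals. -/
theorem exists_biorthogonal_of_not_tendsto {𝕜 X ι : Type*} [RCLike 𝕜] [NormedAddCommGroup X]
    [NormedSpace 𝕜 X] [CompleteSpace X] (U : Ultrafilter ι) (h : ι → X) {R : ℝ}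
    (hR : ∀ n, ‖h n‖ ≤ R) (hU : ∀ x, ¬ Tendsto h U (𝓝 x)) :
    ∃ (φ : ℕ → ι) (f : ℕ → StrongDual 𝕜 X), (∀ i, f i (h (φ i)) = 1) ∧
      ∀ i j, i ≠ j → f i (h (φ j)) = 0 := by
  let J := NormedSpace.inclusionInDoubleDualLi (E := X) 𝕜
  obtain ⟨ξ, hξ⟩ : ∃ ξ : StrongDual 𝕜 (StrongDual 𝕜 X),
      ∀ g : StrongDual 𝕜 X, Tendsto (fun n => J (h n) g) U (𝓝 (ξ g)) := by
    obtain ⟨ξ, -, hξ⟩ := (WeakDual.isCompact_closedBall (𝕜 := 𝕜) (E := StrongDual 𝕜 X) 0 R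
      ).ultrafilter_le_nhds' (U.map fun n => StrongDual.toWeakDual (J (h n))) (by
        rw [Ultrafilter.mem_map]
        refine Filter.Eventually.of_forall fun n => ?_
        have : ‖J (h n)‖ ≤ R := (J.norm_map _).trans_le (hR n)
        simpa using this)
    refine ⟨WeakDual.toStrongDual ξ, fun g => ?_⟩
    exact ((WeakDual.eval_continuous g).tendsto ξ).comp hξ
  refine exists_biorthogonal_of_tendsto_weakly J
    (fun g => NormedSpace.inclusionInDoubleDualLi (E := StrongDual 𝕜 X) 𝕜 g)
    (fun z R hR hz => ?_) U h hU ξ hξ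
  refine ContinuousLinearMap.opNorm_le_bound _ hR fun g => ?_
  have := hz g
  rw [LinearIsometry.norm_map, mul_comm] at this
  exact this

/-! ### Halfspaces of defect at most one -/

/-- `T` maps some halfspace into its sum with a subspace of dimension at most one. -/
def HasDefectOneHalfspace {𝕜 X : Type*} [RCLike 𝕜] [NormedAddCommGroup X] [NormedSpace 𝕜 X]
    (T : X →L[𝕜] X) : Prop :=
  ∃ Y : Submodule 𝕜 X, IsHalfspace Y ∧ ∃ e : X, ∀ y ∈ Y, T y ∈ Y ⊔ Submodule.span 𝕜 {e}

theorem HasDefectOneHalfspace.exists_isAIHS {𝕜 X : Type*} [RCLike 𝕜] [NormedAddCommGroup X]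
    [NormedSpace 𝕜 X] {T : X →L[𝕜] X} (h : HasDefectOneHalfspace T) :
    ∃ Y : Submodule 𝕜 X, IsAIHS T Y ∧ defect T Y ≤ 1 := by
  obtain ⟨Y, hY, e, he⟩ := h
  have hE : IsErrorSubspace T Y (Submodule.span 𝕜 {e}) := ⟨inferInstance, he⟩
  refine ⟨Y, ⟨hY, _, hE⟩, (iInf₂_le _ hE).trans ?_⟩
  exact_mod_cast (finrank_span_le_card ({e} : Set X)).trans (by simp)

/-- Halfspaces of defect at most one lift along quotient maps. -/
theorem HasDefectOneHalfspace.of_semiconj_surjective {𝕜 A B : Type*} [RCLike 𝕜]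
    [NormedAddCommGroup A] [NormedSpace 𝕜 A] [NormedAddCommGroup B] [NormedSpace 𝕜 B]
    {T : A →L[𝕜] A} {S : B →L[𝕜] B} (p : A →L[𝕜] B) (hp : Function.Surjective p)
    (hTS : ∀ x, p (T x) = S (p x)) (h : HasDefectOneHalfspace S) : HasDefectOneHalfspace T := by
  obtain ⟨Y, ⟨hYc, hYi, hYq⟩, e, he⟩ := h
  obtain ⟨e, rfl⟩ := hp e
  refine ⟨Y.comap p.toLinearMap, ⟨hYc.preimage p.continuous, fun hfd => hYi ?_, fun hfd => hYq ?_⟩,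
    e, fun y hy => ?_⟩
  · have h1 : (Y.comap p.toLinearMap).map p.toLinearMap = Y :=
      Submodule.map_comap_eq_of_surjective hp Y
    rw [← h1]
    infer_instance
  · refine Module.Finite.of_surjective
      ((Y.comap p.toLinearMap).mapQ Y p.toLinearMap le_rfl) fun b => ?_
    obtain ⟨b, rfl⟩ := Y.mkQ_surjective b
    obtain ⟨a, rfl⟩ := hp b
    exact ⟨Submodule.Quotient.mk a, rfl⟩
  · obtain ⟨y', hy', z, hz, hyz⟩ := Submodule.mem_sup.1 (he (p y) hy)
    obtain ⟨c, rfl⟩ := Submodule.mem_span_singleton.1 hz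
    refine Submodule.mem_sup.2 ⟨T y - c • e, ?_, c • e,
      Submodule.mem_span_singleton.2 ⟨c, rfl⟩, sub_add_cancel _ _⟩
    rw [Submodule.mem_comap]
    have : p (T y - c • e) = y' := by
      rw [map_sub, map_smul, hTS, ← hyz, add_sub_cancel_right]
    exact this ▸ hy'

/-- Halfspaces of defect at most one extend from closed invariant subspaces. -/
theorem HasDefectOneHalfspace.of_restrict {𝕜 X : Type*} [RCLike 𝕜] [NormedAddCommGroup X]
    [NormedSpace 𝕜 X] {T : X →L[𝕜] X} {A : Submodule 𝕜 X} (hA : IsClosed (A : Set X))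
    {S : A →L[𝕜] A} (hTS : ∀ x : A, (S x : X) = T x) (h : HasDefectOneHalfspace S) :
    HasDefectOneHalfspace T := by
  obtain ⟨Y, ⟨hYc, hYi, hYq⟩, e, he⟩ := h
  refine ⟨Y.map A.subtype, ⟨?_, fun hfd => hYi ?_, fun hfd => hYq ?_⟩, e, ?_⟩
  · rw [Submodule.map_coe]
    exact hA.isClosedEmbedding_subtypeVal.isClosedMap _ hYc
  · exact Module.Finite.equiv (Submodule.equivMapOfInjective A.subtype A.injective_subtype Y).symm
  · refine Module.Finite.of_injective (Y.mapQ (Y.map A.subtype) A.subtype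
      (Submodule.le_comap_map _ _)) ?_
    rw [← LinearMap.ker_eq_bot, Submodule.ker_mapQ,
      Submodule.comap_map_eq_of_injective A.injective_subtype, Submodule.mkQ_map_self]
  · rintro _ ⟨y, hy, rfl⟩
    have h1 := Submodule.mem_map_of_mem (f := A.subtype) (he y hy)
    rw [Submodule.map_sup, Submodule.map_span, Set.image_singleton] at h1
    have h2 : A.subtype (S y) = T (A.subtype y) := hTS y
    rwa [h2] at h1

/-- A biorthogonal sequence consisting of eigenvectors modulo a fixed vector yields a halfspace of
defect at most one. -/
theorem HasDefectOneHalfspace.of_biorthogonal {𝕜 X : Type*} [RCLike 𝕜] [NormedAddCommGroup X]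
    [NormedSpace 𝕜 X] {T : X →L[𝕜] X} (x : ℕ → X) (f : ℕ → StrongDual 𝕜 X)
    (h1 : ∀ i, f i (x i) = 1) (h0 : ∀ i j, i ≠ j → f i (x j) = 0) (e : X)
    (hT : ∀ i, ∃ a b : 𝕜, T (x i) = a • x i + b • e) : HasDefectOneHalfspace T := by
  refine ⟨_, isHalfspace_closure_span_even x f h1 h0, e, ?_⟩
  set Y := (Submodule.span 𝕜 (Set.range fun k => x (2 * k))).topologicalClosure
  have hcl : IsClosed ((Y ⊔ Submodule.span 𝕜 {e} : Submodule 𝕜 X) : Set X) :=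
    Submodule.isClosed_sup_finiteDimensional _ _ (Submodule.isClosed_topologicalClosure _)
  have hle : Y ≤ (Y ⊔ Submodule.span 𝕜 {e}).comap T.toLinearMap := by
    refine Submodule.topologicalClosure_minimal _ (Submodule.span_le.2 ?_)
      (hcl.preimage T.continuous)
    rintro _ ⟨k, rfl⟩
    obtain ⟨a, b, hab⟩ := hT (2 * k)
    change T (x (2 * k)) ∈ Y ⊔ Submodule.span 𝕜 {e}
    rw [hab]
    exact Submodule.add_mem_sup (Submodule.smul_mem _ _ (Submodule.le_topologicalClosure _
      (Submodule.subset_span ⟨k, rfl⟩)))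
      (Submodule.smul_mem _ _ (Submodule.mem_span_singleton_self e))
  exact fun y hy => hle hy

/-- Riesz's lemma gives a bounded 1-separated sequence in the kernel, which cannot converge along a
nonprincipal ultrafilter. -/
theorem HasDefectOneHalfspace.of_ker_infiniteDimensional {𝕜 X : Type*} [RCLike 𝕜]
    [NormedAddCommGroup X] [NormedSpace 𝕜 X] [CompleteSpace X] {T : X →L[𝕜] X}
    (h : ¬ FiniteDimensional 𝕜 (LinearMap.ker T.toLinearMap)) : HasDefectOneHalfspace T := by
  obtain ⟨R, x, -, hR, hx⟩ := exists_seq_norm_le_one_le_norm_sub h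
  obtain ⟨φ, f, h1, h0⟩ := exists_biorthogonal_of_not_tendsto (𝕜 := 𝕜) (hyperfilter ℕ)
    (fun n => (x n : X)) (R := R) hR (fun z hz => by
      have hev := Metric.tendsto_nhds.1 hz (1 / 2) (by norm_num)
      obtain ⟨n, hn⟩ := hev.exists
      have hne : ∀ᶠ m in (hyperfilter ℕ : Filter ℕ), m ≠ n :=
        hyperfilter_le_cofinite (Set.finite_singleton n).compl_mem_cofinite
      obtain ⟨m, hm, hmn⟩ := (hev.and hne).exists
      have h2 : 1 ≤ dist (x m : X) (x n) := by
        rw [dist_eq_norm]; exact hx hmn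
      linarith [dist_triangle_right (x m : X) (x n) z])
  refine .of_biorthogonal (fun i => (x (φ i) : X)) f h1 h0 0 fun i => ⟨0, 0, ?_⟩
  simp

/-! ### Resolvent orbits near the spectrum -/

/-- Points of the resolvent set converging to a point of the spectrum have unbounded resolvents. -/
theorem not_bounded_resolvent {𝕜 A : Type*} [NontriviallyNormedField 𝕜] [NormedRing A]
    [NormedAlgebra 𝕜 A] [CompleteSpace A] [NormOneClass A] {a : A} {t : 𝕜} (ht : t ∈ spectrum 𝕜 a)
    {s : ℕ → 𝕜} (hs : ∀ n, s n ∉ spectrum 𝕜 a) (hst : Tendsto s atTop (𝓝 t)) :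
    ¬ ∃ C, ∀ n, ‖resolvent a (s n)‖ ≤ C := by
  rintro ⟨C, hC⟩
  have hC0 : 0 < C + 1 := by linarith [(norm_nonneg _).trans (hC 0)]
  obtain ⟨n, hn⟩ := (Metric.tendsto_nhds.1 hst (C + 1)⁻¹ (inv_pos.2 hC0)).exists
  obtain ⟨v, hv⟩ := spectrum.notMem_iff.1 (hs n)
  have : Nontrivial A := NormOneClass.nontrivial
  have hvn : ‖(↑v⁻¹ : A)‖ ≤ C := by
    have := hC n
    rwa [resolvent, ← hv, Ring.inverse_unit] at this
  have hlt : ‖(algebraMap 𝕜 A t - a) - v‖ < ‖(↑v⁻¹ : A)‖⁻¹ := by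
    rw [hv, sub_sub_sub_cancel_right, ← map_sub, norm_algebraMap', ← dist_eq_norm, dist_comm]
    refine hn.trans_le (inv_anti₀ (Units.norm_pos _) (by linarith))
  exact spectrum.mem_iff.1 ht ⟨v.ofNearby _ hlt, rfl⟩

theorem HasDefectOneHalfspace.of_no_real_eigenvalue {𝕜 X : Type*} [RCLike 𝕜]
    [NormedAddCommGroup X] [NormedSpace 𝕜 X] [CompleteSpace X] {T : X →L[𝕜] X}
    (hT : ¬ Function.Surjective T) (heig : ∀ (t : ℝ) (x : X), T x = (t : 𝕜) • x → x = 0) :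
    HasDefectOneHalfspace T := by
  have : Nontrivial X := by
    by_contra hcon
    rw [not_nontrivial_iff_subsingleton] at hcon
    exact hT fun y => ⟨y, Subsingleton.elim _ _⟩
  -- Non-surjectivity puts 0 in the spectrum, so the real part of the spectrum is nonempty even over
  -- the reals.
  obtain ⟨t, htR, htmax⟩ : ∃ t : ℝ, IsGreatest {s : ℝ | (s : 𝕜) ∈ spectrum 𝕜 T} t := by
    refine IsCompact.exists_isGreatest ?_ ⟨0, ?_⟩
    · refine Metric.isCompact_of_isClosed_isBounded
        ((spectrum.isClosed T).preimage RCLike.continuous_ofReal) ?_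
      refine (Metric.isBounded_closedBall (x := (0 : ℝ)) (r := ‖T‖)).subset fun s hs => ?_
      have := spectrum.norm_le_norm_of_mem hs
      rw [RCLike.norm_ofReal] at this
      simpa using this
    · change ((0 : ℝ) : 𝕜) ∈ spectrum 𝕜 T
      rw [RCLike.ofReal_zero, spectrum.zero_mem_iff]
      rintro ⟨v, hv⟩
      refine hT fun y => ⟨(↑v⁻¹ : X →L[𝕜] X) y, ?_⟩
      have : ((v : X →L[𝕜] X) * (↑v⁻¹ : X →L[𝕜] X)) y = y := by rw [v.mul_inv]; rfl
      rwa [hv] at this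
  let s : ℕ → ℝ := fun n => t + 1 / ((n : ℝ) + 1)
  have hs : ∀ n, (s n : 𝕜) ∉ spectrum 𝕜 T := fun n hn => by
    have h1 := htmax hn
    have h2 : (0 : ℝ) < 1 / ((n : ℝ) + 1) := by positivity
    simp only [s] at h1
    linarith
  have hst : Tendsto s atTop (𝓝 t) := by
    simpa [s] using (tendsto_one_div_add_atTop_nhds_zero_nat (𝕜 := ℝ)).const_add t
  have hst' : Tendsto (fun n => (s n : 𝕜)) atTop (𝓝 (t : 𝕜)) :=
    (RCLike.continuous_ofReal.tendsto t).comp hst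
  have hres : ∀ n x, T (resolvent T (s n : 𝕜) x) = (s n : 𝕜) • resolvent T (s n : 𝕜) x - x := by
    intro n x
    have h1 : (algebraMap 𝕜 (X →L[𝕜] X) (s n) - T) * resolvent T (s n : 𝕜) = 1 :=
      Ring.mul_inverse_cancel _ (spectrum.notMem_iff.1 (hs n))
    have h2 : (s n : 𝕜) • resolvent T (s n : 𝕜) x - T (resolvent T (s n : 𝕜) x) = x :=
      DFunLike.congr_fun h1 x
    exact eq_sub_of_add_eq' (sub_eq_iff_eq_add.1 h2).symm
  obtain ⟨x, hx⟩ : ∃ x, ¬ ∃ C, ∀ n, ‖resolvent T (s n : 𝕜) x‖ ≤ C := by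
    by_contra! hcon
    exact not_bounded_resolvent htR hs hst' (banach_steinhaus hcon)
  -- `n ≥ k` makes `s (ψ k)` tend to `t`; the bound `k + 1` makes the orbit nonzero and its inverse
  -- norm tend to 0.
  have hlarge : ∀ k : ℕ, ∃ n ≥ k, (k : ℝ) + 1 ≤ ‖resolvent T (s n : 𝕜) x‖ := by
    intro k
    by_contra! hcon
    obtain ⟨C, hC⟩ := Filter.IsBoundedUnder.bddAbove_range
      (f := fun n => ‖resolvent T (s n : 𝕜) x‖)
      ⟨(k : ℝ) + 1, eventually_map.2 (eventually_atTop.2 ⟨k, fun n hn => (hcon n hn).le⟩)⟩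
    exact hx ⟨C, fun n => hC ⟨n, rfl⟩⟩
  choose ψ hψ hψx using hlarge
  set y : ℕ → X := fun k => resolvent T (s (ψ k) : 𝕜) x with hy
  have hy0 : ∀ k, 0 < ‖y k‖ := fun k => lt_of_lt_of_le (by positivity) (hψx k)
  set h : ℕ → X := fun k => ((‖y k‖⁻¹ : ℝ) : 𝕜) • y k with hh
  have hh1 : ∀ k, ‖h k‖ = 1 := fun k => by
    rw [hh, norm_smul, RCLike.norm_ofReal, abs_of_pos (inv_pos.2 (hy0 k)),
      inv_mul_cancel₀ (hy0 k).ne']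
  have hTh : ∀ k, T (h k) = (s (ψ k) : 𝕜) • h k + (-((‖y k‖⁻¹ : ℝ) : 𝕜)) • x := fun k => by
    simp only [hh, hy, map_smul, hres, smul_sub, neg_smul, ← sub_eq_add_neg]
    rw [smul_comm]
  have hψt : Tendsto ψ atTop atTop := tendsto_atTop_mono hψ tendsto_id
  have hinv : Tendsto (fun k => ‖y k‖⁻¹) atTop (𝓝 0) := by
    refine tendsto_inv_atTop_zero.comp (tendsto_atTop_mono (fun k => ?_)
      tendsto_natCast_atTop_atTop)
    linarith [hψx k]
  have hinv' : Tendsto (fun k => (-((‖y k‖⁻¹ : ℝ) : 𝕜)) • x) atTop (𝓝 0) := by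
    have := ((RCLike.continuous_ofReal (K := 𝕜)).tendsto 0).comp hinv
    simpa using this.neg.smul_const x
  obtain ⟨φ, f, h1, h0⟩ := exists_biorthogonal_of_not_tendsto (𝕜 := 𝕜) (hyperfilter ℕ) h
    (R := 1) (fun n => (hh1 n).le) (fun z hz => by
      have hle : (hyperfilter ℕ : Filter ℕ) ≤ atTop := Nat.hyperfilter_le_atTop
      have hlim : Tendsto (fun k => T (h k)) (hyperfilter ℕ) (𝓝 ((t : 𝕜) • z)) := by
        simp only [hTh]
        simpa using (((hst'.comp hψt).mono_left hle).smul hz).add (hinv'.mono_left hle)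
      have hz0 : z = 0 := heig t z
        (tendsto_nhds_unique ((T.continuous.tendsto z).comp hz) hlim)
      have hnorm := hz.norm
      simp only [hh1, hz0, norm_zero] at hnorm
      exact one_ne_zero (tendsto_nhds_unique tendsto_const_nhds hnorm))
  exact .of_biorthogonal (fun i => h (φ i)) f h1 h0 x fun i => ⟨_, _, hTh (φ i)⟩

/-! ### Reduction of the chain -/

theorem HasDefectOneHalfspace.of_chain_iInf_eq_bot {𝕜 X : Type*} [RCLike 𝕜]
    [NormedAddCommGroup X] [NormedSpace 𝕜 X] [CompleteSpace X] (T : X →L[𝕜] X)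
    (V : ℕ → Submodule 𝕜 X) (hVclosed : ∀ n, IsClosed (V n : Set X))
    (hVchain : ∀ n, V (n + 1) < V n) (hTV : ∀ n, ∀ x ∈ V n, T x ∈ V (n + 1))
    (hV : ⨅ n, V n = ⊥) : HasDefectOneHalfspace T := by
  by_cases hker : FiniteDimensional 𝕜 (LinearMap.ker T.toLinearMap)
  swap
  · exact .of_ker_infiniteDimensional hker
  have hanti : Antitone V := antitone_nat_of_succ_le fun n => (hVchain n).le
  have hzero : ∀ x, (∀ n, x ∈ V n) → x = 0 := fun x hx => by
    rwa [← Submodule.mem_bot 𝕜, ← hV, Submodule.mem_iInf]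
  -- The traces of `V n` on the finite-dimensional kernel stabilise, necessarily at zero.
  obtain ⟨N, hN⟩ := IsArtinian.monotone_stabilizes
    (⟨fun n => OrderDual.toDual ((V n).comap (LinearMap.ker T.toLinearMap).subtype),
      fun m n hmn => Submodule.comap_mono (hanti hmn)⟩ :
      ℕ →o (Submodule 𝕜 (LinearMap.ker T.toLinearMap))ᵒᵈ)
  have hkerN : ∀ x ∈ V N, T x = 0 → x = 0 := fun x hx hTx => hzero x fun n => by
    rcases le_total N n with hn | hn
    · have h1 : (V N).comap (LinearMap.ker T.toLinearMap).subtype =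
          (V n).comap (LinearMap.ker T.toLinearMap).subtype := hN n hn
      have h2 : (⟨x, hTx⟩ : LinearMap.ker T.toLinearMap) ∈
        (V N).comap (LinearMap.ker T.toLinearMap).subtype := hx
      rw [h1] at h2
      exact h2
    · exact hanti hn hx
  have : CompleteSpace (V N) := (hVclosed N).completeSpace_coe
  let S : V N →L[𝕜] V N := (T.comp (V N).subtypeL).codRestrict (V N)
    fun x => hanti (Nat.le_succ N) (hTV N x x.2)
  have hS : ∀ x, (S x : X) = T x := fun x => rfl
  refine .of_restrict (hVclosed N) hS (.of_no_real_eigenvalue (fun hsurj => ?_) fun t x hx => ?_)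
  · obtain ⟨z, hz, hz'⟩ := SetLike.exists_of_lt (hVchain N)
    obtain ⟨x, hx⟩ := hsurj ⟨z, hz⟩
    apply hz'
    have := hTV N x x.2
    rwa [← hS, hx] at this
  · have hTx : T x = (t : 𝕜) • (x : X) := by rw [← hS, hx]; rfl
    apply Subtype.ext
    by_cases ht : (t : 𝕜) = 0
    · exact hkerN x x.2 (by rw [hTx, ht, zero_smul])
    · refine hzero x fun n => ?_
      induction n with
      | zero => exact hanti (Nat.zero_le N) x.2
      | succ n ih =>
        have := hTV n x ih
        rw [hTx] at this
        exact ((V (n + 1)).smul_mem_iff ht).1 this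

theorem mainTheorem7 {𝕜 : Type*} {X : Type*} [RCLike 𝕜] [NormedAddCommGroup X] [NormedSpace 𝕜 X]
    [CompleteSpace X] (hX : ¬ FiniteDimensional 𝕜 X) (T : X →L[𝕜] X)
    (V : ℕ → Submodule 𝕜 X) (hVclosed : ∀ n, IsClosed (V n : Set X))
    (hVchain : ∀ n, V (n + 1) < V n) (hTV : ∀ n, ∀ x ∈ V n, T x ∈ V (n + 1)) :
    ∃ Y : Submodule 𝕜 X, IsAIHS T Y ∧ defect T Y ≤ 1 := by
  apply HasDefectOneHalfspace.exists_isAIHS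
  set W : Submodule 𝕜 X := ⨅ n, V n with hW
  have hWclosed : IsClosed (W : Set X) := by
    rw [hW, Submodule.coe_iInf]
    exact isClosed_iInter hVclosed
  have hWV : ∀ n, W ≤ V n := iInf_le V
  have hTW : ∀ x ∈ W, T x ∈ W := fun x hx => by
    rw [hW, Submodule.mem_iInf]
    exact fun n => (hVchain n).le (hTV n x (hWV n hx))
  -- Each `V n` contains `W`, hence is saturated for the quotient map; closedness, strictness and
  -- the zero intersection all pass to the quotient through this.
  have hmem : ∀ n x, W.mkQ x ∈ (V n).map W.mkQ ↔ x ∈ V n := fun n x => by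
    rw [← Submodule.mem_comap, Submodule.comap_map_mkQ, sup_eq_right.2 (hWV n)]
  let S : X ⧸ W →L[𝕜] X ⧸ W := W.liftQL (W.mkQL.comp T) fun x hx => by
    have := (Submodule.Quotient.mk_eq_zero W).2 (hTW x hx)
    exact this
  have hS : ∀ x, W.mkQL (T x) = S (W.mkQL x) := fun x => rfl
  refine .of_semiconj_surjective W.mkQL W.mkQ_surjective hS
    (.of_chain_iInf_eq_bot S (fun n => (V n).map W.mkQ) (fun n => ?_) (fun n => ?_) ?_ ?_)
  · rw [← W.isQuotientMap_mkQL.isClosed_preimage]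
    convert hVclosed n using 1
    ext x
    exact hmem n x
  · refine lt_of_le_of_ne (Submodule.map_mono (hVchain n).le) fun heq => ?_
    obtain ⟨z, hz, hz'⟩ := SetLike.exists_of_lt (hVchain n)
    exact hz' ((hmem _ z).1 (heq ▸ (hmem n z).2 hz))
  · rintro n _ ⟨x, hx, rfl⟩
    exact (hmem (n + 1) (T x)).2 (hTV n x hx)
  · rw [eq_bot_iff]
    intro b hb
    obtain ⟨x, rfl⟩ := W.mkQ_surjective b
    rw [Submodule.mem_iInf] at hb
    rw [Submodule.mem_bot, Submodule.mkQ_apply, Submodule.Quotient.mk_eq_zero, hW,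
      Submodule.mem_iInf]
    exact fun n => (hmem n x).1 (hb n)
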